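/- Let $n\ge 1$, let $[n]=\{1<\dots<n\}$ and let $[n]^\ast$ be the free monoid of words over $[n]$. The plactic monoid $\mathbf{P}_n$ is the monoid generated by $[n]$ subject to the Knuth relations $$zxy=xzy\ \text{ for } x\le y<z,\qquad yzx=yxz\ \text{ for } x<y\le z,\qquad x,y,z\in[n];$$ write $u\approx_{\mathbf{P}_n}v$ if the words $u,v\in[n]^\ast$ represent the same element of $\mathbf{P}_n$. A Young tableau over $[n]$ is a finite, left- and top-justified array of boxes filled with elements of $[n]$, weakly increasing along rows from left to right and strictly increasing down columns; the shape is arbitrary and $\emptyset$ is the empty tableau. Schensted's right insertion of $x\in[n]$ into a tableau inserts $x$ into the first row: if $x$ is greater than or equal to all entries of the row, it is added at the end of the row; otherwise it replaces the leftmost entry that is $>x$, and the replaced entry is inserted into the next row in the same way, and so on. Schensted's left insertion of $x$ inserts $x$ into the first column: if $x$ is strictly greater than all entries of the column, it is added at the bottom of the column; otherwise it replaces the smallest entry that is $\ge x$, and the replaced entry is inserted into the next column in the same way, and so on. For a word $w=x_1\cdots x_k$, let $C_{\mathrm{Yrow}_n}(w)$ be the tableau obtained from $\emptyset$ by right insertion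 of $x_1$, then $x_2,\dots$, then $x_k$, and let $C_{\mathrm{Ycol}_n}(w)$ be the tableau obtained from $\emptyset$ by left insertion of $x_k$, then $x_{k-1},\dots$, then $x_1$. These are the constructors of the right string data structure $\mathrm{Yrow}_n$ and of the left string data structure $\mathrm{Ycol}_n$ of Young tableaux, whose reading map reads the columns from left to right, each from bottom to top. Then $\mathrm{Yrow}_n$ and $\mathrm{Ycol}_n$ both satisfy the cross-section property for $\mathbf{P}_n$: for all words $u,v\in[n]^\ast$, $$u\approx_{\mathbf{P}_n}v\iff C_{\mathrm{Yrow}_n}(u)=C_{\mathrm{Yrow}_n}(v),\qquad\text{and}\qquad u\approx_{\mathbf{P}_n}v\iff C_{\mathrm{Ycol}_n}(u)=C_{\mathrm{Ycol}_n}(v).$$ -/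

import Mathlib

/-! ### String data structures over the alphabet `[n]`, modelled by `Fin n` -/

/-- A right string data structure over `[n]`. The word `u = x₁ ⋯ x_k` is inserted into `d` from its
first letter to its last one, that is `u.toList.foldl insert d`. -/
structure RightStringDataStructure (n : ℕ) where
  /-- the underlying set -/
  D : Type
  /-- the distinguished element -/
  empty : D
  /-- the insertion map -/
  insert : D → Fin n → D
  /-- the reading map -/
  read : D → FreeMonoid (Fin n)
  read_insert_empty : ∀ x, read (insert empty x) = FreeMonoid.of x
  insert_read : ∀ d, (read d).toList.foldl insert empty = d
  read_injective : Function.Injective read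
  read_empty : read empty = 1

/-- A left string data structure over `[n]`. The word `u = x₁ ⋯ x_k` is inserted into `d` from its
last letter to its first one, that is `u.toList.foldr (fun x d => insert d x) d`. -/
structure LeftStringDataStructure (n : ℕ) where
  /-- the underlying set -/
  D : Type
  /-- the distinguished element -/
  empty : D
  /-- the insertion map -/
  insert : D → Fin n → D
  /-- the reading map -/
  read : D → FreeMonoid (Fin n)
  read_insert_empty : ∀ x, read (insert empty x) = FreeMonoid.of x
  insert_read : ∀ d, (read d).toList.foldr (fun x d' => insert d' x) empty = d
  read_injective : Function.Injective read
  read_empty : read empty = 1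

/-- The constructor: insert a word into the distinguished element, from left to right. -/
def RightStringDataStructure.constructor {n : ℕ} (S : RightStringDataStructure n)
    (w : FreeMonoid (Fin n)) : S.D :=
  w.toList.foldl S.insert S.empty

/-- The constructor: insert a word into the distinguished element, from right to left. -/
def LeftStringDataStructure.constructor {n : ℕ} (S : LeftStringDataStructure n)
    (w : FreeMonoid (Fin n)) : S.D :=
  w.toList.foldr (fun x d => S.insert d x) S.empty

/-- The cross-section property for a congruence on the free monoid on `[n]`. -/
def RightStringDataStructure.CrossSectionProperty {n : ℕ} (S : RightStringDataStructure n)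
    (c : Con (FreeMonoid (Fin n))) : Prop :=
  ∀ u v : FreeMonoid (Fin n), c u v ↔ S.constructor u = S.constructor v

/-- The cross-section property for a congruence on the free monoid on `[n]`. -/
def LeftStringDataStructure.CrossSectionProperty {n : ℕ} (S : LeftStringDataStructure n)
    (c : Con (FreeMonoid (Fin n))) : Prop :=
  ∀ u v : FreeMonoid (Fin n), c u v ↔ S.constructor u = S.constructor v

/-! ### The plactic monoid -/

/-- The Knuth relations. -/
inductive KnuthRel (n : ℕ) : FreeMonoid (Fin n) → FreeMonoid (Fin n) → Prop
  | zxy (x y z : Fin n) (hxy : x ≤ y) (hyz : y < z) :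
      KnuthRel n (FreeMonoid.of z * FreeMonoid.of x * FreeMonoid.of y)
        (FreeMonoid.of x * FreeMonoid.of z * FreeMonoid.of y)
  | yzx (x y z : Fin n) (hxy : x < y) (hyz : y ≤ z) :
      KnuthRel n (FreeMonoid.of y * FreeMonoid.of z * FreeMonoid.of x)
        (FreeMonoid.of y * FreeMonoid.of x * FreeMonoid.of z)

/-- The plactic monoid of rank `n`. -/
abbrev PlacticMonoid (n : ℕ) : Type := PresentedMonoid (KnuthRel n)

/-- The congruence on words over `[n]` defined by the plactic monoid: two words are congruent when
they represent the same element of the plactic monoid. -/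
def placticCon (n : ℕ) : Con (FreeMonoid (Fin n)) :=
  Con.ker (PresentedMonoid.mk (KnuthRel n) : FreeMonoid (Fin n) →* PlacticMonoid n)

/-! ### Schensted's insertions

Rows and columns are sequences of boxes indexed by `ℕ`, the empty box being `⊤`. A letter is
likewise an element of `WithTop (Fin n)`, `⊤` being the absent letter. -/

namespace Schensted

variable {n : ℕ}

/-- Insert `x` into the row `r`: the leftmost box whose entry is `> x` (possibly the first empty
box) receives `x`. -/
def rowInsert (r : ℕ → WithTop (Fin n)) (x : WithTop (Fin n)) (j : ℕ) : WithTop (Fin n) :=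
  open Classical in if x < r j ∧ ∀ k < j, r k ≤ x then x else r j

/-- The letter bumped when inserting `x` into the row `r`: the former entry of the leftmost box
whose entry is `> x` (`⊤` if nothing is bumped). -/
noncomputable def rowBump (r : ℕ → WithTop (Fin n)) (x : WithTop (Fin n)) : WithTop (Fin n) :=
  open Classical in if h : ∃ j, x < r j then r (Nat.find h) else ⊤

/-- Insert `x` into the column `c`: the topmost box whose entry is `≥ x` (possibly the first empty
box) receives `x`. -/
def colInsert (c : ℕ → WithTop (Fin n)) (x : WithTop (Fin n)) (i : ℕ) : WithTop (Fin n) :=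
  open Classical in if x ≤ c i ∧ ∀ k < i, c k < x then x else c i

/-- The letter bumped when inserting `x` into the column `c`: the former entry of the topmost box
whose entry is `≥ x` (`⊤` if nothing is bumped). -/
noncomputable def colBump (c : ℕ → WithTop (Fin n)) (x : WithTop (Fin n)) : WithTop (Fin n) :=
  open Classical in if h : ∃ i, x ≤ c i then c (Nat.find h) else ⊤

/-- The letter that arrives in row `i` when `x` is inserted into the first row of `T`. -/
noncomputable def rowLetter (T : ℕ → ℕ → WithTop (Fin n)) (x : WithTop (Fin n)) :
    ℕ → WithTop (Fin n)
  | 0 => x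
  | i + 1 => rowBump (T i) (rowLetter T x i)

/-- The letter that arrives in column `j` when `x` is inserted into the first column of `T`. -/
noncomputable def colLetter (T : ℕ → ℕ → WithTop (Fin n)) (x : WithTop (Fin n)) :
    ℕ → WithTop (Fin n)
  | 0 => x
  | j + 1 => colBump (fun i => T i j) (colLetter T x j)

/-- Schensted's right insertion on arrays; `T i j` is the box in row `i` and column `j`. -/
noncomputable def rightInsert (T : ℕ → ℕ → WithTop (Fin n)) (x : WithTop (Fin n)) (i j : ℕ) :
    WithTop (Fin n) :=
  rowInsert (T i) (rowLetter T x i) j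

/-- Schensted's left insertion on arrays; `T i j` is the box in row `i` and column `j`. -/
noncomputable def leftInsert (T : ℕ → ℕ → WithTop (Fin n)) (x : WithTop (Fin n)) (i j : ℕ) :
    WithTop (Fin n) :=
  colInsert (fun i' => T i' j) (colLetter T x j) i

theorem rowBump_eq {r : ℕ → WithTop (Fin n)} {x : WithTop (Fin n)} {p : ℕ} (h : x < r p)
    (h' : ∀ k < p, r k ≤ x) : rowBump r x = r p := by
  classical
  have hex : ∃ j, x < r j := ⟨p, h⟩
  rw [rowBump, dif_pos hex]
  congr 1
  rw [Nat.find_eq_iff]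
  exact ⟨h, fun k hk => not_lt.2 (h' k hk)⟩

theorem colBump_eq {c : ℕ → WithTop (Fin n)} {x : WithTop (Fin n)} {p : ℕ} (h : x ≤ c p)
    (h' : ∀ k < p, c k < x) : colBump c x = c p := by
  classical
  have hex : ∃ j, x ≤ c j := ⟨p, h⟩
  rw [colBump, dif_pos hex]
  congr 1
  rw [Nat.find_eq_iff]
  exact ⟨h, fun k hk => not_le.2 (h' k hk)⟩

theorem rowBump_top (r : ℕ → WithTop (Fin n)) : rowBump r ⊤ = ⊤ := by
  classical
  rw [rowBump, dif_neg]
  simp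

theorem rowInsert_top (r : ℕ → WithTop (Fin n)) : rowInsert r ⊤ = r := by
  funext j; simp [rowInsert]

/-- The box of the row that receives the inserted letter. -/
theorem exists_rowPos {r : ℕ → WithTop (Fin n)} {x : WithTop (Fin n)} (hx : ∃ j, x < r j) :
    ∃ p, x < r p ∧ (∀ k < p, r k ≤ x) ∧ rowBump r x = r p := by
  classical
  refine ⟨Nat.find hx, Nat.find_spec hx, fun k hk => not_lt.1 (Nat.find_min hx hk), ?_⟩
  rw [rowBump, dif_pos hx]

theorem exists_colPos {c : ℕ → WithTop (Fin n)} {x : WithTop (Fin n)} (hx : ∃ j, x ≤ c j) :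
    ∃ p, x ≤ c p ∧ (∀ k < p, c k < x) ∧ colBump c x = c p := by
  classical
  refine ⟨Nat.find hx, Nat.find_spec hx, fun k hk => not_le.1 (Nat.find_min hx hk), ?_⟩
  rw [colBump, dif_pos hx]

end Schensted

/-! ### Young tableaux -/

/-- A Young tableau over `[n]` (of arbitrary shape): finitely many left- and top-justified boxes
filled with elements of `[n]`, weakly increasing along rows, strictly increasing down columns.
`entry i j` is the content of the box in row `i` (from the top) and column `j` (from the left),
and is `⊤` when this box is empty. -/
@[ext] structure YoungTableau (n : ℕ) where
  /-- the content of the boxes -/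
  entry : ℕ → ℕ → WithTop (Fin n)
  row_le : ∀ i j, entry i j ≤ entry i (j + 1)
  col_lt : ∀ i j, entry (i + 1) j ≠ ⊤ → entry i j < entry (i + 1) j
  exists_eq_top : ∃ j, entry 0 j = ⊤

namespace YoungTableau

variable {n : ℕ}

open Schensted

/-- The empty tableau. -/
def nil (n : ℕ) : YoungTableau n where
  entry _ _ := ⊤
  row_le _ _ := le_rfl
  col_lt _ _ h := absurd rfl h
  exists_eq_top := ⟨0, rfl⟩

/-- The number of (nonempty) columns. -/
noncomputable def numCols (t : YoungTableau n) : ℕ :=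
  open Classical in Nat.find t.exists_eq_top

/-- The `j`-th column of a tableau, listed from bottom to top (it has at most `n` boxes). -/
def colReading (t : YoungTableau n) (j : ℕ) : List (Fin n) :=
  (List.range n).reverse.filterMap fun i => WithTop.recTopCoe none some (t.entry i j)

/-- The south-west reading: column by column from left to right, each from bottom to top. -/
noncomputable def swReading (t : YoungTableau n) : FreeMonoid (Fin n) :=
  FreeMonoid.ofList ((List.range t.numCols).flatMap t.colReading)

theorem row_mono (t : YoungTableau n) (i : ℕ) : Monotone (t.entry i) :=
  monotone_nat_of_le_succ (t.row_le i)

theorem col_lt_or (t : YoungTableau n) (i j : ℕ) :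
    t.entry i j < t.entry (i + 1) j ∨ t.entry (i + 1) j = ⊤ := by
  by_cases h : t.entry (i + 1) j = ⊤
  · exact .inr h
  · exact .inl (t.col_lt i j h)

theorem col_mono (t : YoungTableau n) (j : ℕ) : Monotone (fun i => t.entry i j) :=
  monotone_nat_of_le_succ fun i => by
    rcases t.col_lt_or i j with h | h
    · exact h.le
    · simp [h]

theorem entry_le (t : YoungTableau n) {i i' j j' : ℕ} (hi : i ≤ i') (hj : j ≤ j') :
    t.entry i j ≤ t.entry i' j' :=
  (t.row_mono i hj).trans (t.col_mono j' hi)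

theorem le_of_entry_eq (t : YoungTableau n) (j : ℕ) :
    ∀ (i : ℕ) (x : Fin n), t.entry i j = x → i ≤ x.1
  | 0, _, _ => Nat.zero_le _
  | i + 1, x, h => by
    have hlt := t.col_lt i j (by simp [h])
    rw [h] at hlt
    obtain ⟨y, hy⟩ := WithTop.ne_top_iff_exists.1 hlt.ne_top
    rw [← hy] at hlt
    have := t.le_of_entry_eq j i y hy.symm
    have h2 : y < x := WithTop.coe_lt_coe.1 hlt
    have h3 : y.1 < x.1 := h2
    omega

theorem entry_eq_top_of_le (t : YoungTableau n) {i : ℕ} (j : ℕ) (hi : n ≤ i) :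
    t.entry i j = ⊤ := by
  by_contra h
  obtain ⟨y, hy⟩ := WithTop.ne_top_iff_exists.1 h
  have := t.le_of_entry_eq j i y hy.symm
  have := y.2
  omega

theorem exists_top_row (t : YoungTableau n) : ∃ m, ∀ i j, m ≤ j → t.entry i j = ⊤ := by
  obtain ⟨m, hm⟩ := t.exists_eq_top
  exact ⟨m, fun i j hj => top_le_iff.1 (hm ▸ t.entry_le (Nat.zero_le i) hj)⟩

theorem numCols_spec (t : YoungTableau n) {i j : ℕ} (hj : t.numCols ≤ j) : t.entry i j = ⊤ := by
  classical
  have hm : t.entry 0 t.numCols = ⊤ := Nat.find_spec t.exists_eq_top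
  exact top_le_iff.1 (hm ▸ t.entry_le (Nat.zero_le i) hj)

/-- Schensted's right insertion of `x` into a tableau. -/
noncomputable def rightInsert (t : YoungTableau n) (x : Fin n) : YoungTableau n where
  entry := Schensted.rightInsert t.entry x
  row_le i j := by
    unfold Schensted.rightInsert rowInsert
    have h := t.row_le i j
    split_ifs with h1 h2 h2
    · exact le_rfl
    · exact h1.1.le.trans h
    · exact h2.2 j (Nat.lt_succ_self j)
    · exact h
  col_lt i j := by
    intro hne
    have key : t.entry i j < t.entry (i + 1) j ∨ t.entry (i + 1) j = ⊤ := t.col_lt_or i j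
    unfold Schensted.rightInsert at hne ⊢
    set y := rowLetter t.entry x i with hy
    have hy' : rowLetter t.entry x (i + 1) = rowBump (t.entry i) y := rfl
    rw [hy'] at hne ⊢
    by_cases hj : rowBump (t.entry i) y < t.entry (i + 1) j ∧
        ∀ k < j, t.entry (i + 1) k ≤ rowBump (t.entry i) y
    · have e : rowInsert (t.entry (i + 1)) (rowBump (t.entry i) y) j = rowBump (t.entry i) y := by
        unfold rowInsert; rw [if_pos hj]
      rw [e] at hne ⊢
      have hex : ∃ p, y < t.entry i p := by
        by_contra hno
        apply hne
        rw [rowBump, dif_neg hno]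
      obtain ⟨p, hp1, hp2, hp3⟩ := exists_rowPos hex
      rw [hp3] at hj hne ⊢
      have hjp : j ≤ p := by
        by_contra hlt
        have h1 := hj.2 p (not_le.1 hlt)
        rcases t.col_lt_or i p with h2 | h2
        · exact absurd (h2.trans_le h1) (lt_irrefl _)
        · rw [h2, top_le_iff] at h1
          exact hne h1
      unfold rowInsert
      split_ifs with h1
      · exact hp1
      · rcases hjp.lt_or_eq with h2 | rfl
        · exact (hp2 j h2).trans_lt hp1
        · exact absurd ⟨hp1, hp2⟩ h1
    · have e : rowInsert (t.entry (i + 1)) (rowBump (t.entry i) y) j = t.entry (i + 1) j := by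
        unfold rowInsert; rw [if_neg hj]
      rw [e] at hne ⊢
      have hlt := t.col_lt i j hne
      unfold rowInsert
      split_ifs with h1
      · exact h1.1.trans hlt
      · exact hlt
  exists_eq_top := by
    obtain ⟨m, hm⟩ := t.exists_top_row
    refine ⟨m + 1, ?_⟩
    unfold Schensted.rightInsert rowInsert
    rw [if_neg, hm _ _ (Nat.le_succ m)]
    rintro ⟨-, h⟩
    have := h m (Nat.lt_succ_self m)
    rw [hm _ _ le_rfl, top_le_iff] at this
    exact WithTop.coe_ne_top this

/-- Schensted's left insertion of `x` into a tableau. -/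
noncomputable def leftInsert (t : YoungTableau n) (x : Fin n) : YoungTableau n where
  entry := Schensted.leftInsert t.entry x
  row_le i j := by
    unfold Schensted.leftInsert
    set y := colLetter t.entry x j with hy
    have hy' : colLetter t.entry x (j + 1) = colBump (fun i => t.entry i j) y := rfl
    rw [hy']
    have hex : ∃ p, y ≤ t.entry p j := ⟨n, by simp [t.entry_eq_top_of_le j le_rfl]⟩
    obtain ⟨p, hp1, hp2, hp3⟩ := exists_colPos (c := fun i => t.entry i j) hex
    rw [hp3]
    by_cases hi : t.entry p j ≤ t.entry i (j + 1) ∧ ∀ k < i, t.entry k (j + 1) < t.entry p j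
    · have e : colInsert (fun i' => t.entry i' (j + 1)) (t.entry p j) i = t.entry p j := by
        unfold colInsert; rw [if_pos hi]
      rw [e]
      have hip : i ≤ p := by
        by_contra hlt
        exact absurd ((hi.2 p (not_le.1 hlt)).trans_le (t.row_le p j)) (lt_irrefl _)
      unfold colInsert
      split_ifs with h1
      · exact hp1
      · rcases hip.lt_or_eq with h2 | rfl
        · exact (hp2 i h2).le.trans hp1
        · exact le_rfl
    · have e : colInsert (fun i' => t.entry i' (j + 1)) (t.entry p j) i = t.entry i (j + 1) := by
        unfold colInsert; rw [if_neg hi]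
      rw [e]
      unfold colInsert
      split_ifs with h1
      · exact h1.1.trans (t.row_le i j)
      · exact t.row_le i j
  col_lt i j := by
    unfold Schensted.leftInsert colInsert
    intro hne
    split_ifs at hne ⊢ with h1 h2 h2
    · exact absurd (h2.2 i (Nat.lt_succ_self i)) (not_lt.2 h1.1)
    · exact h1.1.trans_lt (t.col_lt i j hne)
    · exact h2.2 i (Nat.lt_succ_self i)
    · exact t.col_lt i j hne
  exists_eq_top := by
    obtain ⟨m, hm⟩ := t.exists_top_row
    refine ⟨m + 1, ?_⟩
    have e : colLetter t.entry x (m + 1) = ⊤ := by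
      have hex : ∃ p, colLetter t.entry x m ≤ t.entry p m := ⟨0, by simp [hm 0 m le_rfl]⟩
      obtain ⟨p, -, -, h3⟩ := exists_colPos (c := fun i => t.entry i m) hex
      exact h3.trans (hm p m le_rfl)
    unfold Schensted.leftInsert colInsert
    rw [e]
    split_ifs
    · rfl
    · exact hm 0 (m + 1) (Nat.le_succ m)

theorem foldl_entry (l : List (Fin n)) (t : YoungTableau n) :
    (l.foldl rightInsert t).entry =
      l.foldl (fun T (x : Fin n) => Schensted.rightInsert T (x : WithTop (Fin n))) t.entry := by
  induction l generalizing t with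
  | nil => rfl
  | cons x l ih => simp only [List.foldl_cons]; rw [ih]; rfl

theorem foldr_entry (l : List (Fin n)) (t : YoungTableau n) :
    (l.foldr (fun x d => leftInsert d x) t).entry =
      l.foldr (fun (x : Fin n) T => Schensted.leftInsert T (x : WithTop (Fin n))) t.entry := by
  induction l with
  | nil => rfl
  | cons x l ih => simp only [List.foldr_cons]; rw [← ih]; rfl

/-- The first `k` columns of `t`, followed by its column `k` without its `q` topmost boxes. -/
def leftPart (t : YoungTableau n) (k q i j : ℕ) : WithTop (Fin n) :=
  if j < k then t.entry i j else if j = k then t.entry (i + q) k else ⊤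

/-- The columns `k, k + 1, …` of `t`, with the rows `i ≥ q` moved left by one box. -/
def rightPart (t : YoungTableau n) (k q i j : ℕ) : WithTop (Fin n) :=
  if i < q then t.entry i (k + j) else t.entry i (k + 1 + j)

theorem rightInsert_leftPart (t : YoungTableau n) (k q : ℕ) :
    Schensted.rightInsert (t.leftPart k (q + 1)) (t.entry q k) = t.leftPart k q := by
  have hle : ∀ i, ∀ j < k, t.leftPart k (q + 1) i j ≤ t.entry (i + q) k := by
    intro i j hj
    rw [leftPart, if_pos hj]
    exact t.entry_le (Nat.le_add_right i q) hj.le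
  have hk : ∀ i, t.leftPart k (q + 1) i k = t.entry (i + q + 1) k := by
    intro i; simp [leftPart, Nat.add_assoc]
  have hlt : ∀ i, t.entry (i + q) k ≠ ⊤ → t.entry (i + q) k < t.leftPart k (q + 1) i k := by
    intro i hi
    rw [hk]
    rcases t.col_lt_or (i + q) k with h | h
    · exact h
    · rw [h]; exact lt_top_iff_ne_top.2 hi
  have hL : ∀ i, rowLetter (t.leftPart k (q + 1)) (t.entry q k) i = t.entry (i + q) k := by
    intro i
    induction i with
    | zero => simp [rowLetter]
    | succ i ih =>
      rw [rowLetter, ih]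
      by_cases h : t.entry (i + q) k = ⊤
      · rw [h, rowBump_top]
        have := t.col_mono k (show i + q ≤ i + 1 + q by omega)
        simp only [h, top_le_iff] at this
        exact this.symm
      · rw [rowBump_eq (hlt i h) (hle i), hk]
        congr 1; omega
  funext i j
  rw [Schensted.rightInsert, hL]
  by_cases h : t.entry (i + q) k = ⊤
  · rw [h, rowInsert_top]
    have := t.col_mono k (show i + q ≤ i + (q + 1) by omega)
    simp only [h, top_le_iff] at this
    simp [leftPart, h, this]
  · unfold rowInsert
    rcases lt_trichotomy j k with hj | rfl | hj
    · rw [if_neg fun hh => absurd hh.1 (not_lt.2 (hle i j hj))]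
      simp [leftPart, hj]
    · rw [if_pos ⟨hlt i h, hle i⟩]
      simp [leftPart]
    · rw [if_neg fun hh => absurd (hh.2 k hj) (not_le.2 (hlt i h))]
      simp [leftPart, hj.not_gt, hj.ne']

theorem leftInsert_rightPart (t : YoungTableau n) (k q : ℕ) :
    Schensted.leftInsert (t.rightPart k q) (t.entry q k) = t.rightPart k (q + 1) := by
  by_cases htop : t.entry q k = ⊤
  · have h0 : ∀ i j, q ≤ i → t.entry i (k + j) = ⊤ := fun i j hi =>
      top_le_iff.1 (htop ▸ t.entry_le hi (Nat.le_add_right k j))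
    have hL : ∀ j, colLetter (t.rightPart k q) ⊤ j = ⊤ := by
      intro j
      induction j with
      | zero => rfl
      | succ j ih =>
        rw [colLetter, ih, colBump]
        split_ifs with h
        · classical
          have := Nat.find_spec h
          simpa using this
        · rfl
    funext i j
    rw [htop, Schensted.leftInsert, hL]
    have e : colInsert (fun i' => t.rightPart k q i' j) ⊤ i = t.rightPart k q i j := by
      unfold colInsert
      split_ifs with h
      · exact (top_le_iff.1 h.1).symm
      · rfl
    rw [e]
    have h1 : ∀ i, q ≤ i → t.entry i (k + 1 + j) = ⊤ := fun i hi => by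
      have := h0 i (1 + j) hi
      rwa [← Nat.add_assoc] at this
    unfold rightPart
    split_ifs with h2 h3 h3
    · rfl
    · omega
    · rw [h0 i j (by omega), h1 i (by omega)]
    · rfl
  · have hle : ∀ j, t.entry q (k + j) ≤ t.rightPart k q q j := by
      intro j
      simp only [rightPart, lt_irrefl, if_false]
      exact t.row_mono q (by omega)
    have hlt : ∀ j, t.entry q (k + j) ≠ ⊤ →
        ∀ i < q, t.rightPart k q i j < t.entry q (k + j) := by
      intro j hj i hi
      simp only [rightPart, hi, if_true]
      obtain ⟨q', rfl⟩ : ∃ q', q = q' + 1 := ⟨q - 1, by omega⟩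
      have h1 : t.entry i (k + j) ≤ t.entry q' (k + j) := t.col_mono (k + j) (by omega : i ≤ q')
      exact h1.trans_lt (t.col_lt _ _ hj)
    have hpos : ∀ j, t.entry q (k + j) ≠ ⊤ →
        colBump (fun i => t.rightPart k q i j) (t.entry q (k + j)) = t.entry q (k + (j + 1)) := by
      intro j hj
      rw [colBump_eq (c := fun i => t.rightPart k q i j) (hle j) (hlt j hj)]
      simp only [rightPart, lt_irrefl, if_false]
      congr 1; omega
    have hL : ∀ j, colLetter (t.rightPart k q) (t.entry q k) j = t.entry q (k + j) := by
      intro j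
      induction j with
      | zero => rfl
      | succ j ih =>
        rw [colLetter, ih]
        by_cases hj : t.entry q (k + j) = ⊤
        · have h1 : t.entry q (k + (j + 1)) = ⊤ :=
            top_le_iff.1 (hj ▸ t.row_mono q (by omega : k + j ≤ k + (j + 1)))
          rw [hj, h1, colBump]
          split_ifs with h
          · classical
            have := Nat.find_spec h
            simpa using this
          · rfl
        · exact hpos j hj
    funext i j
    rw [Schensted.leftInsert, hL]
    by_cases hj : t.entry q (k + j) = ⊤
    · rw [hj]
      have e : colInsert (fun i' => t.rightPart k q i' j) ⊤ i = t.rightPart k q i j := by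
        unfold colInsert
        split_ifs with h
        · exact (top_le_iff.1 h.1).symm
        · rfl
      rw [e]
      unfold rightPart
      split_ifs with h2 h3 h3
      · rfl
      · omega
      · obtain rfl : i = q := by omega
        rw [hj]
        exact top_le_iff.1 (hj ▸ t.row_mono i (by omega : k + j ≤ k + 1 + j))
      · rfl
    · unfold colInsert
      rcases lt_trichotomy i q with hi | rfl | hi
      · rw [if_neg fun hh => absurd hh.1 (not_le.2 (hlt j hj i hi))]
        simp [rightPart, hi, Nat.lt_succ_of_lt hi]
      · rw [if_pos ⟨hle j, hlt j hj⟩]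
        simp [rightPart]
      · rw [if_neg fun hh => absurd (hh.2 q hi) (not_lt.2 (hle j))]
        have h1 : ¬ i < q := by omega
        have h2 : ¬ i < q + 1 := by omega
        simp [rightPart, h1, h2]

theorem foldl_rows (t : YoungTableau n) (k m : ℕ) :
    ((List.range m).reverse.filterMap fun i => WithTop.recTopCoe (C := fun _ => Option (Fin n))
        none some (t.entry i k)).foldl
      (fun T (x : Fin n) => Schensted.rightInsert T (x : WithTop (Fin n))) (t.leftPart k m) =
      t.leftPart k 0 := by
  induction m with
  | zero => rfl
  | succ m ih =>
    rw [List.range_succ, List.reverse_append, List.reverse_singleton, List.singleton_append,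
      List.filterMap_cons]
    have key := t.rightInsert_leftPart k m
    cases hx : t.entry m k with
    | top =>
      have e : t.leftPart k (m + 1) = t.leftPart k m := by
        funext i j
        have h1 : t.entry (i + (m + 1)) k = ⊤ :=
          top_le_iff.1 (hx ▸ t.col_mono k (by omega : m ≤ i + (m + 1)))
        have h2 : t.entry (i + m) k = ⊤ :=
          top_le_iff.1 (hx ▸ t.col_mono k (by omega : m ≤ i + m))
        simp [leftPart, h1, h2]
      rw [e]
      exact ih
    | coe x =>
      rw [hx] at key
      simp only [WithTop.recTopCoe_coe, List.foldl_cons]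
      rw [key]
      exact ih

theorem foldr_rows (t : YoungTableau n) (k m : ℕ) :
    ((List.range m).reverse.filterMap fun i => WithTop.recTopCoe (C := fun _ => Option (Fin n))
        none some (t.entry i k)).foldr
      (fun (x : Fin n) T => Schensted.leftInsert T (x : WithTop (Fin n))) (t.rightPart k 0) =
      t.rightPart k m := by
  induction m with
  | zero => rfl
  | succ m ih =>
    rw [List.range_succ, List.reverse_append, List.reverse_singleton, List.singleton_append,
      List.filterMap_cons]
    have key := t.leftInsert_rightPart k m
    cases hx : t.entry m k with
    | top =>
      refine ih.trans ?_
      funext i j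
      by_cases hi : i = m
      · subst hi
        have h1 : t.entry i (k + j) = ⊤ :=
          top_le_iff.1 (hx ▸ t.row_mono i (by omega : k ≤ k + j))
        have h2 : t.entry i (k + 1 + j) = ⊤ :=
          top_le_iff.1 (hx ▸ t.row_mono i (by omega : k ≤ k + 1 + j))
        simp [rightPart, h1, h2]
      · have : i < m ↔ i < m + 1 := by omega
        simp [rightPart, this]
    | coe x =>
      rw [hx] at key
      simp only [WithTop.recTopCoe_coe, List.foldr_cons]
      rw [ih, key]

theorem foldl_cols (t : YoungTableau n) (m : ℕ) :
    ((List.range m).flatMap t.colReading).foldl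
      (fun T (x : Fin n) => Schensted.rightInsert T (x : WithTop (Fin n))) (nil n).entry =
      fun i j => if j < m then t.entry i j else ⊤ := by
  induction m with
  | zero => funext i j; simp [nil]
  | succ m ih =>
    rw [List.range_succ, List.flatMap_append, List.foldl_append, ih, List.flatMap_singleton]
    have h := t.foldl_rows m n
    have e : (fun i j => if j < m then t.entry i j else ⊤) = t.leftPart m n := by
      funext i j
      simp [leftPart, t.entry_eq_top_of_le m (Nat.le_add_left n i)]
    rw [e]
    refine h.trans ?_
    funext i j
    rcases lt_trichotomy j m with hj | rfl | hj
    · simp [leftPart, hj, Nat.lt_succ_of_lt hj]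
    · simp [leftPart]
    · have h1 : ¬ j < m := by omega
      have h2 : ¬ j < m + 1 := by omega
      simp [leftPart, h1, h2, hj.ne']

theorem foldr_cols (t : YoungTableau n) (m : ℕ) :
    ((List.range m).flatMap t.colReading).foldr
      (fun (x : Fin n) T => Schensted.leftInsert T (x : WithTop (Fin n))) (fun i j => t.entry i (m + j)) =
      t.entry := by
  induction m with
  | zero => funext i j; simp
  | succ m ih =>
    rw [List.range_succ, List.flatMap_append, List.foldr_append, List.flatMap_singleton]
    have h := t.foldr_rows m n
    have e : (fun i j => t.entry i (m + 1 + j)) = t.rightPart m 0 := by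
      funext i j; simp [rightPart]
    have e' : t.rightPart m n = fun i j => t.entry i (m + j) := by
      funext i j
      unfold rightPart
      split_ifs with hi
      · rfl
      · rw [t.entry_eq_top_of_le _ (not_lt.1 hi), t.entry_eq_top_of_le _ (not_lt.1 hi)]
    rw [e]
    unfold colReading at ih ⊢
    rw [h, e']
    exact ih

theorem foldl_swReading (t : YoungTableau n) :
    t.swReading.toList.foldl rightInsert (nil n) = t := by
  ext1
  rw [foldl_entry]
  refine (t.foldl_cols t.numCols).trans ?_
  funext i j
  split_ifs with h
  · rfl
  · exact (t.numCols_spec (not_lt.1 h)).symm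

theorem foldr_swReading (t : YoungTableau n) :
    t.swReading.toList.foldr (fun x d => leftInsert d x) (nil n) = t := by
  ext1
  rw [foldr_entry]
  have e : (nil n).entry = fun i j => t.entry i (t.numCols + j) := by
    funext i j
    exact (t.numCols_spec (Nat.le_add_right _ j)).symm
  rw [e]
  exact t.foldr_cols t.numCols

theorem swReading_injective : Function.Injective (swReading (n := n)) := by
  intro s t h
  rw [← s.foldl_swReading, h, t.foldl_swReading]

theorem swReading_nil : (nil n).swReading = 1 := by
  classical
  have : (nil n).numCols = 0 := by
    rw [numCols, Nat.find_eq_zero]; rfl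
  rw [swReading, this]
  rfl

theorem swReading_of_single (t : YoungTableau n) (x : Fin n)
    (h : ∀ i j, t.entry i j = if i = 0 ∧ j = 0 then (x : WithTop (Fin n)) else ⊤) :
    t.swReading = FreeMonoid.of x := by
  classical
  have h1 : t.numCols = 1 := by
    rw [numCols, Nat.find_eq_iff]
    refine ⟨by simp [h], fun m hm => ?_⟩
    obtain rfl : m = 0 := by omega
    simp [h]
  have h2 : t.colReading 0 = [x] := by
    obtain ⟨m, rfl⟩ : ∃ m, n = m + 1 := ⟨n - 1, by have := x.2; omega⟩
    rw [colReading, List.range_succ_eq_map, List.reverse_cons, List.filterMap_append]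
    simp only [h, List.filterMap_cons, List.filterMap_nil, and_true, if_true]
    rw [WithTop.recTopCoe_coe]
    simp only [List.append_eq_singleton_iff]
    left
    refine ⟨?_, trivial⟩
    rw [List.filterMap_eq_nil_iff]
    intro a ha
    have ha' : a ≠ 0 := by
      rintro rfl
      simp at ha
    rw [if_neg ha']
    rfl
  rw [swReading, h1]
  simp [h2]

theorem swReading_rightInsert_nil (x : Fin n) :
    ((nil n).rightInsert x).swReading = FreeMonoid.of x := by
  apply swReading_of_single
  have h0 : rowBump ((nil n).entry 0) (x : WithTop (Fin n)) = ⊤ := by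
    rw [rowBump_eq (p := 0) (WithTop.coe_lt_top x) (by simp)]
    rfl
  have hL : ∀ i, rowLetter (nil n).entry x (i + 1) = ⊤ := by
    intro i
    induction i with
    | zero => exact h0
    | succ i ih => rw [rowLetter, ih, rowBump_top]
  intro i j
  change Schensted.rightInsert (nil n).entry x i j = _
  rw [Schensted.rightInsert]
  cases i with
  | zero =>
    rw [rowLetter]
    cases j with
    | zero => simp [rowInsert, nil]
    | succ j =>
      unfold rowInsert
      rw [if_neg (fun hh => WithTop.coe_ne_top (top_le_iff.1 (hh.2 0 (Nat.succ_pos j))))]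
      simp [nil]
  | succ i =>
    rw [hL, rowInsert_top]
    simp [nil]

theorem swReading_leftInsert_nil (x : Fin n) :
    ((nil n).leftInsert x).swReading = FreeMonoid.of x := by
  apply swReading_of_single
  have hL : ∀ j, colLetter (nil n).entry x (j + 1) = ⊤ := by
    intro j
    rw [colLetter]
    obtain ⟨p, -, -, h⟩ := exists_colPos (c := fun i => (nil n).entry i j)
      (x := colLetter (nil n).entry x j) ⟨0, le_top⟩
    exact h
  intro i j
  change Schensted.leftInsert (nil n).entry x i j = _
  rw [Schensted.leftInsert]
  cases j with
  | zero =>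
    rw [colLetter]
    cases i with
    | zero => simp [colInsert, nil]
    | succ i =>
      unfold colInsert
      rw [if_neg (fun hh => not_top_lt (hh.2 0 (Nat.succ_pos i)))]
      simp [nil]
  | succ j =>
    rw [hL]
    unfold colInsert
    have h0 : ¬ (i = 0 ∧ j + 1 = 0) := by simp
    refine Eq.trans ?_ (if_neg h0).symm
    split_ifs <;> rfl

end YoungTableau

/-- The right string data structure of Young tableaux with Schensted's right (row) insertion. -/
noncomputable def Yrow (n : ℕ) : RightStringDataStructure n where
  D := YoungTableau n
  empty := YoungTableau.nil n
  insert := YoungTableau.rightInsert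
  read := YoungTableau.swReading
  read_insert_empty := YoungTableau.swReading_rightInsert_nil
  insert_read := YoungTableau.foldl_swReading
  read_injective := YoungTableau.swReading_injective
  read_empty := YoungTableau.swReading_nil

/-- The left string data structure of Young tableaux with Schensted's left (column) insertion. -/
noncomputable def Ycol (n : ℕ) : LeftStringDataStructure n where
  D := YoungTableau n
  empty := YoungTableau.nil n
  insert := YoungTableau.leftInsert
  read := YoungTableau.swReading
  read_insert_empty := YoungTableau.swReading_leftInsert_nil
  insert_read := YoungTableau.foldr_swReading
  read_injective := YoungTableau.swReading_injective
  read_empty := YoungTableau.swReading_nil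

/-! Two invariance statements, one for each insertion, combine to give both equivalences.

Right insertion is constant on plactic classes. It suffices to follow the two sides of one Knuth
relation through a single row: they leave the same row, and the two bumped triples are again Knuth
related, up to absent letters. So the comparison propagates from row to row (`TripleRel.rowCompat`,
`TripleRel.rightInsert_eq`).

Left insertion does not change the plactic class: for a column `C`, Knuth relations turn `x C` into
`C' x'`, with `C'` the column after insertion and `x'` the bumped letter
(`letterClass_mul_colClass_update`). Passing through all columns, `x` times the reading of a tableau
is congruent to the reading of its left insertion, so every word `w` is congruent to the reading of
`C_Ycol(w)` (`placticCon_swReading`).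

Right insertion of the reading of a tableau restores that tableau. Hence right insertion of `w`,
which agrees with that of the reading of `C_Ycol(w)`, yields `C_Ycol(w)`: the two constructors
coincide. Invariance of right insertion gives one implication, the congruence with readings gives
the converse. -/

/-! ### Right insertion respects the Knuth relations -/

namespace Schensted

variable {n : ℕ}

/-- The letter `x` is received by box `p` of the row `r`. -/
def IsRowPos (r : ℕ → WithTop (Fin n)) (x : WithTop (Fin n)) (p : ℕ) : Prop :=
  x < r p ∧ ∀ k < p, r k ≤ x

theorem IsRowPos.unique {r : ℕ → WithTop (Fin n)} {x : WithTop (Fin n)} {p q : ℕ}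
    (hp : IsRowPos r x p) (hq : IsRowPos r x q) : p = q := by
  rcases lt_trichotomy p q with h | h | h
  · exact absurd (hq.2 p h) (not_le.2 hp.1)
  · exact h
  · exact absurd (hp.2 q h) (not_le.2 hq.1)

theorem IsRowPos.rowInsert_eq {r : ℕ → WithTop (Fin n)} {x : WithTop (Fin n)} {p : ℕ}
    (hp : IsRowPos r x p) : rowInsert r x = Function.update r p x := by
  funext j
  by_cases hj : j = p
  · subst hj
    rw [Function.update_self]
    exact if_pos hp
  · rw [Function.update_of_ne hj]
    exact if_neg fun h => hj (IsRowPos.unique h hp)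

theorem IsRowPos.rowBump_eq {r : ℕ → WithTop (Fin n)} {x : WithTop (Fin n)} {p : ℕ}
    (hp : IsRowPos r x p) : rowBump r x = r p :=
  Schensted.rowBump_eq hp.1 hp.2

theorem exists_isRowPos {r : ℕ → WithTop (Fin n)} {x : WithTop (Fin n)} (hr : ∃ j, r j = ⊤)
    (hx : x ≠ ⊤) : ∃ p, IsRowPos r x p := by
  obtain ⟨j, hj⟩ := hr
  obtain ⟨p, h1, h2, -⟩ := exists_rowPos (r := r) (x := x) ⟨j, hj ▸ lt_top_iff_ne_top.2 hx⟩
  exact ⟨p, h1, h2⟩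

/-- Insert three letters, one after the other, into a row. -/
def rowInsert₃ (r : ℕ → WithTop (Fin n)) (a b c : WithTop (Fin n)) : ℕ → WithTop (Fin n) :=
  rowInsert (rowInsert (rowInsert r a) b) c

/-- Knuth's relations on triples of letters, the absent letter `⊤` commuting with all others. -/
inductive TripleRel : WithTop (Fin n) → WithTop (Fin n) → WithTop (Fin n) →
    WithTop (Fin n) → WithTop (Fin n) → WithTop (Fin n) → Prop
  | zxy {x y z : WithTop (Fin n)} : x ≤ y → y < z → TripleRel z x y x z y
  | yzx {x y z : WithTop (Fin n)} : x < y → y ≤ z → TripleRel y z x y x z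
  | top_left (a b : WithTop (Fin n)) : TripleRel ⊤ a b a ⊤ b
  | top_right (a b : WithTop (Fin n)) : TripleRel a ⊤ b a b ⊤
  | symm {a b c a' b' c' : WithTop (Fin n)} : TripleRel a b c a' b' c' → TripleRel a' b' c' a b c

/-- Inserting two related triples into a row yields the same row, and bumps related triples. -/
def RowCompat (r : ℕ → WithTop (Fin n)) (a b c a' b' c' : WithTop (Fin n)) : Prop :=
  rowInsert₃ r a b c = rowInsert₃ r a' b' c' ∧
    TripleRel (rowBump r a) (rowBump (rowInsert r a) b) (rowBump (rowInsert (rowInsert r a) b) c)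
      (rowBump r a') (rowBump (rowInsert r a') b') (rowBump (rowInsert (rowInsert r a') b') c')

/-- Let `p ≤ q` be the boxes of `r` that receive `x` and `z`. If `p < q`, the two insertions commute
and the bumped triples are related by `zxy` again. If `p = q`, the insertions interfere, and the
bumped triples are related by `yzx` instead. -/
theorem rowCompat_zxy {r : ℕ → WithTop (Fin n)} (hm : Monotone r) (ht : ∃ j, r j = ⊤)
    {x y z : WithTop (Fin n)} (hxy : x ≤ y) (hyz : y < z) (hz : z ≠ ⊤) :
    RowCompat r z x y x z y := by
  have hxz := hxy.trans_lt hyz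
  obtain ⟨p, hp⟩ := exists_isRowPos ht hxz.ne_top
  obtain ⟨q, hq⟩ := exists_isRowPos ht hz
  have hpq : p ≤ q := by
    by_contra h
    exact absurd (hp.2 q (not_le.1 h)) (not_le.2 (hxz.trans hq.1))
  rcases hpq.lt_or_eq with hlt | rfl
  · have hp' : IsRowPos (Function.update r q z) x p := by
      refine ⟨by rw [Function.update_of_ne hlt.ne]; exact hp.1, fun k hk => ?_⟩
      rw [Function.update_of_ne (by omega)]
      exact hp.2 k hk
    have hq' : IsRowPos (Function.update r p x) z q := by
      refine ⟨by rw [Function.update_of_ne hlt.ne']; exact hq.1, fun k hk => ?_⟩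
      by_cases hkp : k = p
      · rw [hkp, Function.update_self]; exact hxz.le
      · rw [Function.update_of_ne hkp]; exact hq.2 k hk
    have hcomm : Function.update (Function.update r q z) p x =
        Function.update (Function.update r p x) q z := Function.update_comm hlt.ne' _ _ _
    unfold RowCompat rowInsert₃
    rw [hq.rowInsert_eq, hp.rowInsert_eq, hp'.rowInsert_eq, hq'.rowInsert_eq, hq.rowBump_eq,
      hp.rowBump_eq, hp'.rowBump_eq, hq'.rowBump_eq, Function.update_of_ne hlt.ne,
      Function.update_of_ne hlt.ne', hcomm]
    refine ⟨rfl, ?_⟩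
    -- Both orders have now produced the same row `s`; it remains to see that `y` enters it at a box
    -- `l` with `p < l ≤ q`, hence bumps a letter that is at least `r p` and less than `r q`.
    set s := Function.update (Function.update r p x) q z with hs
    have hsq : s q = z := Function.update_self ..
    obtain ⟨l, hl⟩ := exists_isRowPos (r := s) (x := y)
      (by obtain ⟨j, hj⟩ := ht
          -- An index to the right of both modified boxes at which `r` is empty.
          refine ⟨max j (q + 1), ?_⟩
          rw [hs, Function.update_of_ne (by omega), Function.update_of_ne (by omega)]
          exact top_le_iff.1 (hj ▸ hm (le_max_left _ _))) hyz.ne_top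
    rw [hl.rowBump_eq]
    have hlq : l ≤ q := by
      by_contra h
      exact absurd (hl.2 q (not_le.1 h)) (not_le.2 (hsq ▸ hyz))
    have hpl : p < l := by
      rcases lt_trichotomy p l with h | rfl | h
      · exact h
      · have := hl.1
        rw [hs, Function.update_of_ne hlt.ne, Function.update_self] at this
        exact absurd hxy (not_le.2 this)
      · have := hl.1
        rw [hs, Function.update_of_ne (by omega), Function.update_of_ne (by omega)] at this
        exact absurd ((hp.2 l h).trans hxy) (not_le.2 this)
    rcases hlq.lt_or_eq with h | rfl
    · have e : s l = r l := by
        rw [hs, Function.update_of_ne (by omega), Function.update_of_ne (by omega)]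
      rw [e]
      exact .zxy (hm hpl.le) ((hq.2 l h).trans_lt hq.1)
    · rw [hsq]
      exact .zxy (hq.2 p hlt) hq.1
  -- Case `p = q`. In the order `z, x, y`, the letter `x` bumps `z` back out and `y` bumps `r (p +
  -- 1)`; in the order `x, z, y`, the letter `z` bumps `r (p + 1)` and is then bumped by `y`. Both
  -- rows end with `x, y` in boxes `p, p + 1`.
  · have h1 : IsRowPos (Function.update r p z) x p :=
      ⟨by rwa [Function.update_self], fun k hk => by
        rw [Function.update_of_ne hk.ne]; exact hp.2 k hk⟩
    -- Since `z < r p ≤ r (p + 1)`, box `p + 1` is the first one whose entry exceeds `w`.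
    have hstep : ∀ w, x ≤ w → w ≤ z → IsRowPos (Function.update r p x) w (p + 1) := by
      refine fun w h1 h2 => ⟨?_, fun k hk => ?_⟩
      · rw [Function.update_of_ne (by omega)]
        exact h2.trans_lt (hq.1.trans_le (hm (Nat.le_succ p)))
      · rcases (Nat.lt_succ_iff.1 hk).lt_or_eq with h | rfl
        · rw [Function.update_of_ne h.ne]; exact (hp.2 k h).trans h1
        · rwa [Function.update_self]
    have h2 := hstep z hxz.le le_rfl
    have h3 := hstep y hxy hyz.le
    have h4 : IsRowPos (Function.update (Function.update r p x) (p + 1) z) y (p + 1) :=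
      ⟨by rwa [Function.update_self], fun k hk => by
        rw [Function.update_of_ne hk.ne]; exact h3.2 k hk⟩
    unfold RowCompat rowInsert₃
    rw [hq.rowInsert_eq, hp.rowInsert_eq, h1.rowInsert_eq, h2.rowInsert_eq, hq.rowBump_eq,
      hp.rowBump_eq, h1.rowBump_eq, h2.rowBump_eq, Function.update_idem, h3.rowInsert_eq,
      h4.rowInsert_eq, h3.rowBump_eq, h4.rowBump_eq, Function.update_idem]
    refine ⟨rfl, ?_⟩
    simp only [Function.update_self, Function.update_of_ne (Nat.succ_ne_self p)]
    exact .symm (.yzx hq.1 (hm (Nat.le_succ p)))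

/-- Once `y` sits in box `q`, it separates the other two letters: `x` enters at some `p ≤ q` and `z`
at some `l > q`, so their insertions commute. The letters bumped by `x`, `y`, `z` satisfy the
inequalities of `yzx` again. -/
theorem rowCompat_yzx {r : ℕ → WithTop (Fin n)} (hm : Monotone r) (ht : ∃ j, r j = ⊤)
    {x y z : WithTop (Fin n)} (hxy : x < y) (hyz : y ≤ z) (hz : z ≠ ⊤) :
    RowCompat r y z x y x z := by
  obtain ⟨q, hq⟩ := exists_isRowPos ht (ne_top_of_le_ne_top hz hyz)
  unfold RowCompat rowInsert₃
  rw [hq.rowInsert_eq, hq.rowBump_eq]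
  set s := Function.update r q y with hs
  have hsq : s q = y := Function.update_self ..
  have hs' : ∃ j, s j = ⊤ := by
    obtain ⟨j, hj⟩ := ht
    refine ⟨max j (q + 1), ?_⟩
    rw [hs, Function.update_of_ne (by omega)]
    exact top_le_iff.1 (hj ▸ hm (le_max_left _ _))
  obtain ⟨p, hp⟩ := exists_isRowPos hs' hxy.ne_top
  obtain ⟨l, hl⟩ := exists_isRowPos hs' hz
  have hpq : p ≤ q := by
    by_contra h
    exact absurd (hp.2 q (not_le.1 h)) (not_le.2 (hsq ▸ hxy))
  have hql : q < l := by
    have h1 := hl.1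
    rcases lt_trichotomy q l with h | rfl | h
    · exact h
    · exact absurd h1 (not_lt.2 (hsq ▸ hyz))
    · rw [hs, Function.update_of_ne h.ne] at h1
      exact absurd (hyz.trans_lt h1) (not_lt.2 (hq.2 l h))
  have hp' : IsRowPos (Function.update s l z) x p := by
    refine ⟨by rw [Function.update_of_ne (by omega)]; exact hp.1, fun k hk => ?_⟩
    rw [Function.update_of_ne (by omega)]
    exact hp.2 k hk
  have hl' : IsRowPos (Function.update s p x) z l := by
    refine ⟨by rw [Function.update_of_ne (by omega)]; exact hl.1, fun k hk => ?_⟩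
    by_cases hkp : k = p
    · rw [hkp, Function.update_self]; exact hxy.le.trans hyz
    · rw [Function.update_of_ne hkp]; exact hl.2 k hk
  rw [hp.rowInsert_eq, hl.rowInsert_eq, hp'.rowInsert_eq, hl'.rowInsert_eq, hp.rowBump_eq,
    hl.rowBump_eq, hp'.rowBump_eq, hl'.rowBump_eq, Function.update_of_ne (by omega),
    Function.update_of_ne (by omega)]
  refine ⟨Function.update_comm (by omega) _ _ _, .yzx ?_ ?_⟩
  · rcases hpq.lt_or_eq with h | rfl
    · rw [hs, Function.update_of_ne h.ne]
      exact (hq.2 p h).trans_lt hq.1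
    · exact hsq ▸ hq.1
  · rw [hs, Function.update_of_ne hql.ne']
    exact hm hql.le

theorem TripleRel.rowCompat {r : ℕ → WithTop (Fin n)} (hm : Monotone r) (ht : ∃ j, r j = ⊤)
    {a b c a' b' c' : WithTop (Fin n)} (h : TripleRel a b c a' b' c') :
    RowCompat r a b c a' b' c' := by
  have hleft : ∀ a b, RowCompat r ⊤ a b a ⊤ b := fun a b => by
    unfold RowCompat rowInsert₃
    simp only [rowInsert_top, rowBump_top]
    exact ⟨trivial, .top_left _ _⟩
  have hright : ∀ a b, RowCompat r a ⊤ b a b ⊤ := fun a b => by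
    unfold RowCompat rowInsert₃
    simp only [rowInsert_top, rowBump_top]
    exact ⟨trivial, .top_right _ _⟩
  induction h with
  | @zxy x y z hxy hyz =>
    -- For `z = ⊤`, the letter bumped by `y` may be `⊤` too, so the strict inequality of `zxy` can
    -- be lost in the next row; `top_left` requires no inequality and is preserved.
    by_cases hz : z = ⊤
    · subst hz; exact hleft _ _
    · exact rowCompat_zxy hm ht hxy hyz hz
  | @yzx x y z hxy hyz =>
    by_cases hz : z = ⊤
    · subst hz; exact hright _ _
    · exact rowCompat_yzx hm ht hxy hyz hz
  | top_left a b => exact hleft _ _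
  | top_right a b => exact hright _ _
  | symm _ ih => exact ⟨ih.1.symm, ih.2.symm⟩

/-! ### From one row to whole tableaux -/

theorem rowLetter_succ (T : ℕ → ℕ → WithTop (Fin n)) (x : WithTop (Fin n)) (i : ℕ) :
    rowLetter T x (i + 1) = rowLetter (fun i' => T (i' + 1)) (rowBump (T 0) x) i := by
  induction i with
  | zero => rfl
  | succ i ih => rw [rowLetter, ih]; rfl

theorem rightInsert_succ (T : ℕ → ℕ → WithTop (Fin n)) (x : WithTop (Fin n)) :
    (fun i => rightInsert T x (i + 1)) =
      rightInsert (fun i => T (i + 1)) (rowBump (T 0) x) := by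
  funext i j
  rw [rightInsert, rowLetter_succ]
  rfl

/-- Induction on the row index: below the first row, everything happens as if the bumped triples
were inserted into the remaining rows, and these triples are related again. -/
theorem TripleRel.rightInsert_eq {a b c a' b' c' : WithTop (Fin n)} (h : TripleRel a b c a' b' c')
    (T : ℕ → ℕ → WithTop (Fin n)) (hm : ∀ i, Monotone (T i)) (ht : ∀ i, ∃ j, T i j = ⊤) :
    rightInsert (rightInsert (rightInsert T a) b) c =
      rightInsert (rightInsert (rightInsert T a') b') c' := by
  funext i
  induction i generalizing T a b c a' b' c' with
  | zero => exact (h.rowCompat (hm 0) (ht 0)).1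
  | succ i ih =>
    have key := ih (h.rowCompat (hm 0) (ht 0)).2 (fun i => T (i + 1)) (fun i => hm _) fun i => ht _
    have unfold₃ : ∀ a b c, rightInsert (rightInsert (rightInsert T a) b) c (i + 1) =
        rightInsert (rightInsert (rightInsert (fun i => T (i + 1)) (rowBump (T 0) a))
          (rowBump (rowInsert (T 0) a) b)) (rowBump (rowInsert (rowInsert (T 0) a) b) c) i := by
      intro a b c
      rw [← rightInsert_succ T a]
      change _ = rightInsert (rightInsert (fun i => rightInsert T a (i + 1))
        (rowBump (rightInsert T a 0) b)) (rowBump (rightInsert (rightInsert T a) b 0) c) i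
      rw [← rightInsert_succ, ← rightInsert_succ]
    rw [unfold₃, unfold₃]
    exact key

end Schensted

theorem KnuthRel.foldl_rightInsert {n : ℕ} {u v : FreeMonoid (Fin n)} (h : KnuthRel n u v)
    (t : YoungTableau n) :
    u.toList.foldl YoungTableau.rightInsert t = v.toList.foldl YoungTableau.rightInsert t := by
  have ht : ∀ i, ∃ j, t.entry i j = ⊤ := fun i => ⟨t.numCols, t.numCols_spec le_rfl⟩
  cases h with
  | zxy x y z hxy hyz =>
    exact YoungTableau.ext ((Schensted.TripleRel.zxy (WithTop.coe_le_coe.2 hxy)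
      (WithTop.coe_lt_coe.2 hyz)).rightInsert_eq t.entry t.row_mono ht)
  | yzx x y z hxy hyz =>
    exact YoungTableau.ext ((Schensted.TripleRel.yzx (WithTop.coe_lt_coe.2 hxy)
      (WithTop.coe_le_coe.2 hyz)).rightInsert_eq t.entry t.row_mono ht)

/-- Words with the same class in the plactic monoid act equally by right insertion. -/
theorem foldl_rightInsert_eq_of_placticCon {n : ℕ} {u v : FreeMonoid (Fin n)}
    (h : placticCon n u v) (t : YoungTableau n) :
    u.toList.foldl YoungTableau.rightInsert t = v.toList.foldl YoungTableau.rightInsert t := by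
  have h' : conGen (KnuthRel n) u v := PresentedMonoid.mk_eq_mk_iff.1 h
  clear h
  rw [← Con.rel_eq_coe] at h'
  change ConGen.Rel (KnuthRel n) u v at h'
  -- The tableau must vary: in a product, the second factor acts on the result of the first.
  induction h' generalizing t with
  | of _ _ h => exact h.foldl_rightInsert t
  | refl _ => rfl
  | symm _ ih => exact (ih t).symm
  | trans _ _ ih₁ ih₂ => exact (ih₁ t).trans (ih₂ t)
  | mul _ _ ih₁ ih₂ =>
    rw [FreeMonoid.toList_mul, FreeMonoid.toList_mul, List.foldl_append, List.foldl_append, ih₁,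
      ih₂]

/-! ### Left insertion and the plactic monoid -/

namespace Schensted

variable {n : ℕ}

/-- The class of a letter in the plactic monoid, the absent letter being trivial. -/
def letterClass (x : WithTop (Fin n)) : PlacticMonoid n :=
  WithTop.recTopCoe 1 (fun y => PresentedMonoid.of (KnuthRel n) y) x

/-- The class of the first `m` boxes of a column, read from bottom to top. -/
def colClass (c : ℕ → WithTop (Fin n)) : ℕ → PlacticMonoid n
  | 0 => 1
  | m + 1 => letterClass (c m) * colClass c m

theorem letterClass_top : letterClass (⊤ : WithTop (Fin n)) = 1 := rfl

/-- Only `z` can be absent without making another letter absent, and then both sides lose it.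
Allowing this lets empty boxes take part in column computations. -/
theorem letterClass_zxy {x y z : WithTop (Fin n)} (hxy : x ≤ y) (hyz : y < z) :
    letterClass z * letterClass x * letterClass y =
      letterClass x * letterClass z * letterClass y := by
  induction z using WithTop.recTopCoe with
  | top => simp [letterClass_top]
  | coe z =>
    lift y to Fin n using hyz.ne_top
    lift x to Fin n using (hxy.trans_lt hyz).ne_top
    exact PresentedMonoid.mk_eq_mk_of_rel (.zxy x y z (WithTop.coe_le_coe.1 hxy)
      (WithTop.coe_lt_coe.1 hyz))

theorem letterClass_yzx {x y z : WithTop (Fin n)} (hxy : x < y) (hyz : y ≤ z) :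
    letterClass y * letterClass z * letterClass x =
      letterClass y * letterClass x * letterClass z := by
  induction z using WithTop.recTopCoe with
  | top => simp [letterClass_top]
  | coe z =>
    lift y to Fin n using ne_top_of_le_ne_top WithTop.coe_ne_top hyz
    lift x to Fin n using hxy.ne_top
    exact PresentedMonoid.mk_eq_mk_of_rel (.yzx x y z (WithTop.coe_lt_coe.1 hxy)
      (WithTop.coe_le_coe.1 hyz))

theorem colClass_congr {c d : ℕ → WithTop (Fin n)} {m : ℕ} (h : ∀ k < m, c k = d k) :
    colClass c m = colClass d m := by
  induction m with
  | zero => rfl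
  | succ m ih => rw [colClass, colClass, ih fun k hk => h k (by omega), h m (Nat.lt_succ_self m)]

/-- A letter moves to the right through a column of smaller letters. -/
theorem letterClass_mul_colClass {c : ℕ → WithTop (Fin n)}
    (hc : ∀ i, c i < c (i + 1) ∨ c (i + 1) = ⊤) {a b : WithTop (Fin n)} {m : ℕ}
    (hm : ∀ k < m, c k < a) (hab : a ≤ b) :
    letterClass a * letterClass b * colClass c m =
      letterClass a * colClass c m * letterClass b := by
  induction m generalizing a with
  | zero => simp [colClass]
  | succ m ih =>
    have h1 := hm m (Nat.lt_succ_self m)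
    have hlt : ∀ k < m, c k < c m := by
      have hmono : Monotone c := monotone_nat_of_le_succ fun i => by
        rcases hc i with h | h
        · exact h.le
        · simp [h]
      intro k hk
      obtain ⟨l, rfl⟩ : ∃ l, m = l + 1 := ⟨m - 1, by omega⟩
      refine (hmono (by omega : k ≤ l)).trans_lt ((hc l).resolve_right h1.ne_top)
    -- The relation `yzx` moves `b` past `c m`, with `a` as left neighbour; then `c m` plays the
    -- part of `a` for the boxes above it.
    rw [colClass, ← mul_assoc, letterClass_yzx h1 hab, mul_assoc (letterClass a), mul_assoc
      (letterClass a), ih hlt (h1.le.trans hab)]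
    simp only [mul_assoc]

/-- Reading from the bottom, `x` moves right past each box under `p` by `zxy`, the box just above
that one acting as the letter `y`. When it meets `c p`, only smaller letters remain, and `c p` moves
out to the right through them by `letterClass_mul_colClass`. -/
theorem letterClass_mul_colClass_update {c : ℕ → WithTop (Fin n)}
    (hc : ∀ i, c i < c (i + 1) ∨ c (i + 1) = ⊤) {x : WithTop (Fin n)} {p m : ℕ}
    (hp : x ≤ c p) (hp' : ∀ k < p, c k < x) (hm : p + 1 ≤ m) :
    letterClass x * colClass c m = colClass (Function.update c p x) m * letterClass (c p) := by
  have hmono : Monotone c := monotone_nat_of_le_succ fun i => by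
    rcases hc i with h | h
    · exact h.le
    · simp [h]
  induction m, hm using Nat.le_induction with
  | base =>
    rw [colClass, colClass, Function.update_self, ← mul_assoc, letterClass_mul_colClass hc hp' hp,
      colClass_congr (c := Function.update c p x) (d := c)
        fun k hk => Function.update_of_ne hk.ne _ _]
  | succ m hm ih =>
    obtain ⟨l, rfl⟩ : ∃ l, m = l + 1 := ⟨m - 1, by omega⟩
    rw [colClass, colClass.eq_2 (Function.update c p x), Function.update_of_ne (by omega),
      mul_assoc (letterClass (c (l + 1))), ← ih]
    rcases hc l with h | h
    · rw [colClass, ← mul_assoc, ← mul_assoc,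
        ← letterClass_zxy (hp.trans (hmono (by omega : p ≤ l))) h]
      simp only [mul_assoc]
    · simp [h, letterClass_top]

end Schensted

/-! ### From one column to whole tableaux -/

namespace YoungTableau

open Schensted

variable {n : ℕ}

theorem colLetter_eq_top (t : YoungTableau n) (x : WithTop (Fin n)) {j : ℕ} (hj : t.numCols < j) :
    colLetter t.entry x j = ⊤ := by
  obtain ⟨l, rfl⟩ : ∃ l, j = l + 1 := ⟨j - 1, by omega⟩
  obtain ⟨p, -, -, h⟩ := exists_colPos (c := fun i => t.entry i l) (x := colLetter t.entry x l)
    ⟨0, by simp [t.numCols_spec (Nat.lt_succ_iff.1 hj)]⟩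
  exact h.trans (t.numCols_spec (Nat.lt_succ_iff.1 hj))

theorem letterClass_mul_colClass_entry (t : YoungTableau n) (j : ℕ) (y : WithTop (Fin n)) :
    letterClass y * colClass (fun i => t.entry i j) n =
      colClass (colInsert (fun i => t.entry i j) y) n *
        letterClass (colBump (fun i => t.entry i j) y) := by
  obtain ⟨p, hp, hp', hb⟩ := exists_colPos (c := fun i => t.entry i j) (x := y)
    ⟨n, by simp [t.entry_eq_top_of_le j le_rfl]⟩
  have hins : colInsert (fun i => t.entry i j) y = Function.update (fun i => t.entry i j) p y := by
    funext i
    unfold colInsert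
    rcases lt_trichotomy i p with h | rfl | h
    · rw [if_neg fun hh => absurd hh.1 (not_le.2 (hp' i h)), Function.update_of_ne h.ne]
    · rw [if_pos ⟨hp, hp'⟩, Function.update_self]
    · rw [if_neg fun hh => absurd (hh.2 p h) (not_lt.2 hp), Function.update_of_ne h.ne']
  rw [hins, hb]
  by_cases hpn : p < n
  · exact letterClass_mul_colClass_update (t.col_lt_or · j) hp hp' hpn
  -- A proper letter is received within the first `n` boxes: otherwise the box in row `n - 1` would
  -- hold a letter of index at least `n - 1` and yet less than `y`. So `y` is absent and the column
  -- does not change.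
  · have hy : y = ⊤ := by
      by_contra hy
      lift y to Fin n using hy
      have key : ∀ k : ℕ, k < p → ∃ a : Fin n, t.entry k j = a ∧ k ≤ a.1 ∧ a < y := by
        intro k hk
        have h := hp' k hk
        obtain ⟨a, ha⟩ := WithTop.ne_top_iff_exists.1 h.ne_top
        exact ⟨a, ha.symm, t.le_of_entry_eq j k a ha.symm,
          WithTop.coe_lt_coe.1 (ha.trans_lt h)⟩
      obtain ⟨a, -, ha, hay⟩ := key (n - 1) (by have := y.2; omega)
      have := y.2
      have : a.1 < y.1 := hay
      omega
    subst hy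
    have htop : t.entry p j = ⊤ := top_le_iff.1 hp
    rw [htop, ← htop, Function.update_eq_self (f := fun i => t.entry i j), htop, letterClass_top,
      one_mul, mul_one]

/-- The class of the first `m` columns of a tableau. -/
def colsClass (t : YoungTableau n) : ℕ → PlacticMonoid n
  | 0 => 1
  | m + 1 => colsClass t m * colClass (fun i => t.entry i m) n

/-- The travelling letter leaves each column in its inserted state and goes on as the letter bumped
from it. -/
theorem letterClass_mul_colsClass (t : YoungTableau n) (x : Fin n) (m : ℕ) :
    letterClass x * t.colsClass m =
      (t.leftInsert x).colsClass m * letterClass (colLetter t.entry x m) := by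
  induction m with
  | zero => simp [colsClass, colLetter]
  | succ m ih =>
    rw [colsClass, ← mul_assoc, ih, mul_assoc, letterClass_mul_colClass_entry, ← mul_assoc]
    rfl

theorem mk_ofList_filterMap (c : ℕ → WithTop (Fin n)) (m : ℕ) :
    PresentedMonoid.mk (KnuthRel n) (FreeMonoid.ofList ((List.range m).reverse.filterMap fun i =>
      WithTop.recTopCoe (C := fun _ => Option (Fin n)) none some (c i))) = colClass c m := by
  induction m with
  | zero => rfl
  | succ m ih =>
    rw [List.range_succ, List.reverse_append, List.reverse_singleton, List.singleton_append,
      List.filterMap_cons, colClass, ← ih]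
    cases c m with
    | top => exact (one_mul _).symm
    | coe x => rfl

theorem mk_ofList_flatMap (t : YoungTableau n) (m : ℕ) :
    PresentedMonoid.mk (KnuthRel n) (FreeMonoid.ofList ((List.range m).flatMap t.colReading)) =
      t.colsClass m := by
  induction m with
  | zero => rfl
  | succ m ih =>
    rw [List.range_succ, List.flatMap_append, List.flatMap_singleton, FreeMonoid.ofList_append,
      map_mul, ih, colsClass, colReading, mk_ofList_filterMap]

/-- Empty columns are trivial, so tableaux with different numbers of columns can be compared at a
common `m`. -/
theorem colsClass_of_numCols_le (t : YoungTableau n) {m : ℕ} (hm : t.numCols ≤ m) :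
    t.colsClass m = t.colsClass t.numCols := by
  have hnil : ∀ l, colClass (fun _ => (⊤ : WithTop (Fin n))) l = 1 := fun l => by
    induction l with
    | zero => rfl
    | succ l ih => rw [colClass, ih, letterClass_top, one_mul]
  induction m, hm using Nat.le_induction with
  | base => rfl
  | succ m hm ih =>
    have : (fun i => t.entry i m) = fun _ => ⊤ := funext fun i => t.numCols_spec hm
    rw [colsClass, ih, this, hnil, mul_one]

theorem mk_swReading_leftInsert (t : YoungTableau n) (x : Fin n) :
    PresentedMonoid.mk (KnuthRel n) (t.leftInsert x).swReading =
      PresentedMonoid.mk (KnuthRel n) (FreeMonoid.of x * t.swReading) := by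
  -- All columns of both tableaux are counted; the `+ 1` is there because a proper letter may still
  -- arrive in column `t.numCols`, but not beyond.
  set m := max t.numCols (t.leftInsert x).numCols + 1
  have h := t.letterClass_mul_colsClass x m
  rw [t.colLetter_eq_top x (by omega), letterClass_top, mul_one,
    colsClass_of_numCols_le t (by omega),
    colsClass_of_numCols_le (t.leftInsert x) (by omega)] at h
  rw [map_mul, swReading, swReading, mk_ofList_flatMap, mk_ofList_flatMap, ← h]
  rfl

/-- Every word is plactically congruent to the reading of its left insertion tableau. -/
theorem placticCon_swReading (w : FreeMonoid (Fin n)) :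
    placticCon n ((Ycol n).constructor w).swReading w := by
  change PresentedMonoid.mk (KnuthRel n) _ = PresentedMonoid.mk (KnuthRel n) _
  induction w using FreeMonoid.recOn with
  | one => exact congrArg _ swReading_nil
  | of_mul x w ih =>
    refine (mk_swReading_leftInsert _ x).trans ?_
    rw [map_mul, map_mul]
    exact congrArg _ ih

/-- Left and right insertion of a word produce the same tableau. -/
theorem constructor_Yrow_eq_Ycol (w : FreeMonoid (Fin n)) :
    (Yrow n).constructor w = (Ycol n).constructor w :=
  -- Right insertion of `w` equals right insertion of the congruent word read from its left
  -- insertion tableau, which rebuilds that tableau.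
  (foldl_rightInsert_eq_of_placticCon (placticCon_swReading w) (nil n)).symm.trans
    (foldl_swReading _)

end YoungTableau

theorem mainTheorem3 (n : ℕ) :
    (Yrow n).CrossSectionProperty (placticCon n) ∧
      (Ycol n).CrossSectionProperty (placticCon n) := by
  have hcol : (Ycol n).CrossSectionProperty (placticCon n) := fun u v => by
    refine ⟨fun h => ?_, fun h => ?_⟩
    · rw [← YoungTableau.constructor_Yrow_eq_Ycol, ← YoungTableau.constructor_Yrow_eq_Ycol]
      exact foldl_rightInsert_eq_of_placticCon h (YoungTableau.nil n)
    · refine ((placticCon n).symm (YoungTableau.placticCon_swReading u)).trans ?_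
      rw [h]
      exact YoungTableau.placticCon_swReading v
  refine ⟨fun u v => (hcol u v).trans ?_, hcol⟩
  have e := @YoungTableau.constructor_Yrow_eq_Ycol n
  exact Eq.congr (e u).symm (e v).symm
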